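/- **Conventions.** All first-order models have at least two elements; signatures are arbitrary. A *team* $X$ over a model $\mathfrak M$ with (finite) domain $V$ is a set of assignments $s:V\to M$, and for a $k$-tuple of terms $t$ with variables in $V$, $X(t)=\{s(t):s\in X\}\subseteq M^k$. A ($k$-ary first order) *dependency* $\mathbf D$ is a first order sentence $\mathbf D(R)$ over the signature $\{R\}$, with $R$ a $k$-ary relation symbol. For a family $\mathcal D$ of dependencies (of possibly different arities), $\mathrm{FO}(\mathcal D)$ is first order logic in negation normal form with the additional atoms $\mathbf D\,t$ ($\mathbf D\in\mathcal D$, $t$ a tuple of terms of the arity of $\mathbf D$), interpreted by Team Semantics: - $\mathfrak M\models_X\alpha$, for a first order literal $\alpha$, iff every $s\in X$ satisfies $\alpha$; - $\mathfrak M\models_X\mathbf D\,t$ iff $(M,X(t))\models\mathbf D(R)$ in the usual Tarskian sense; - $\mathfrak M\models_X\psi_1\vee\psi_2$ iff $X=Y\cup Z$ for some $Y,Z$ with $\mathfrak M\models_Y\psi_1$ and $\mathfrak M\models_Z\psi_2$; - $\mathfrak M\models_X\psi_1\wedge\psi_2$ iff $\mathfrak M\models_X\psi_1$ and $\mathfrak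 M\models_X\psi_2$; - $\mathfrak M\models_X\exists v\,\psi$ iff there is a function $H$ assigning to each $s\in X$ a nonempty set $H(s)\subseteq M$ such that $\{s[m/v]:s\in X,\ m\in H(s)\}$ satisfies $\psi$; - $\mathfrak M\models_X\forall v\,\psi$ iff $\{s[m/v]:s\in X,\ m\in M\}$ satisfies $\psi$. A sentence is true in $\mathfrak M$ if it is satisfied by the team $\{\varepsilon\}$ containing only the empty assignment. Two sentences are equivalent if they are true in the same models (with at least two elements). A family $\mathcal E$ of dependencies is *safe* for $\mathcal D$ if every sentence of $\mathrm{FO}(\mathcal E\cup\mathcal D)$ is equivalent to some sentence of $\mathrm{FO}(\mathcal D)$ over the same signature. A dependency $\mathbf E$ is *definable* in $\mathrm{FO}(\mathcal D)$ if, for every signature and every tuple $v$ of distinct variables of the arity of $\mathbf E$, there is a formula $\psi$ of $\mathrm{FO}(\mathcal D)$ with free variables among $v$ such that $\mathfrak M\models_X\mathbf E\,v$ iff $\mathfrak M\models_X\psi$, for all models $\mathfrak M$ and all teams $X$ with domain $v$. Consider the dependencies of all arities $k\ge 0$ $$\mathrm{NC}(R):=\exists x\,\exists y\,(Rx\wedge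 Ry\wedge x\ne y),\qquad \mathrm{NE}(R):=\exists x\,Rx,\qquad \mathrm{All}(R):=\forall x\,Rx,$$ where $x,y$ are $k$-tuples of variables. **Corollary.** 1. For every model $\mathfrak M$, team $X$ and tuple of terms $t$ with variables in the domain of $X$: $\mathfrak M\models_X\mathrm{NC}(t)$ iff $t$ takes at least two values in $X$, i.e. $|X(t)|\ge 2$; and $\mathfrak M\models_X\mathrm{NE}(t)$ iff $|X(t)|>0$. 2. For every family $\mathcal D$ of dependencies, the family of the non-constancy dependencies $\mathrm{NC}$ (of all arities) is safe for $\mathcal D$, and so is the family of the nonemptiness dependencies $\mathrm{NE}$ (of all arities). 3. Every non-constancy dependency and every nonemptiness dependency is definable in $\mathrm{FO}(\mathrm{All})$, where $\mathrm{All}$ is the family of the totality dependencies of all arities. -/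

import Mathlib

universe u v w

namespace TeamSem

open FirstOrder FirstOrder.Language

/-! ### First order dependencies -/

/-- The relation symbols of the signature `{R}`: a single symbol `R`, of arity `k`. -/
inductive RelSymb (k : ℕ) : ℕ → Type
  | R : RelSymb k k

/-- The signature `{R}` with one `k`-ary relation symbol. -/
@[reducible] def relLang (k : ℕ) : FirstOrder.Language.{0, 0} := ⟨fun _ => Empty, RelSymb k⟩

/-- The `{R}`-structure `(M, S)` in which `R` is interpreted as the `k`-ary relation `S`. -/
@[reducible] def relStructure {M : Type w} {k : ℕ} (S : Set (Fin k → M)) : (relLang k).Structure M where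
  funMap := fun f => f.elim
  RelMap := fun r => match r with
    | RelSymb.R => fun a => a ∈ S

/-- A first order dependency: a first order sentence over the signature `{R}`, where `R` is a
relation symbol of the given arity. -/
structure Dependency where
  arity : ℕ
  sentence : (relLang arity).Sentence

/-- `d.Holds S` says that `(M, S) ⊨ d(R)`, in the usual Tarskian sense. -/
def Dependency.Holds (d : Dependency) {M : Type w} (S : Set (Fin d.arity → M)) : Prop :=
  @Sentence.Realize (relLang d.arity) M (relStructure S) d.sentence

/-! ### Syntax of `FO(D)` -/

/-- Formulas of `FO(D)` over the signature `L`, in negation normal form, whose free variables lie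
in the finite set `V`.  Variables are indexed by the natural numbers. -/
inductive TeamFormula (L : FirstOrder.Language.{u, v}) (D : Set Dependency) : Finset ℕ → Type (max u v)
  | eq {V : Finset ℕ} (t₁ t₂ : L.Term V) : TeamFormula L D V
  | ne {V : Finset ℕ} (t₁ t₂ : L.Term V) : TeamFormula L D V
  | rel {V : Finset ℕ} {n : ℕ} (r : L.Relations n) (ts : Fin n → L.Term V) : TeamFormula L D V
  | nrel {V : Finset ℕ} {n : ℕ} (r : L.Relations n) (ts : Fin n → L.Term V) : TeamFormula L D V
  | dep {V : Finset ℕ} (d : Dependency) (hd : d ∈ D) (ts : Fin d.arity → L.Term V) :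
      TeamFormula L D V
  | or {V : Finset ℕ} (φ ψ : TeamFormula L D V) : TeamFormula L D V
  | and {V : Finset ℕ} (φ ψ : TeamFormula L D V) : TeamFormula L D V
  | ex {V : Finset ℕ} (x : ℕ) (φ : TeamFormula L D (insert x V)) : TeamFormula L D V
  | all {V : Finset ℕ} (x : ℕ) (φ : TeamFormula L D (insert x V)) : TeamFormula L D V

/-- Sentences of `FO(D)` over the signature `L`. -/
abbrev TeamSentence (L : FirstOrder.Language.{u, v}) (D : Set Dependency) : Type (max u v) :=
  TeamFormula L D ∅

/-! ### Team Semantics -/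

/-- Teams over `M` with domain `V`: sets of assignments `V → M`. -/
abbrev Team (M : Type w) (V : Finset ℕ) : Type w := Set (V → M)

/-- The assignment `s[m/x]`, with domain `V ∪ {x}`. -/
def updateAt {M : Type w} {V : Finset ℕ} (s : V → M) (x : ℕ) (m : M) :
    ↥(insert x V) → M :=
  fun y => if h : y.1 = x then m else s ⟨y.1, Finset.mem_of_mem_insert_of_ne y.2 h⟩

/-- The supplemented team `X[H/x]`. -/
def Team.supplement {M : Type w} {V : Finset ℕ} (X : Team M V) (x : ℕ) (H : (V → M) → Set M) :
    Team M (insert x V) :=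
  {s' | ∃ s ∈ X, ∃ m ∈ H s, s' = updateAt s x m}

/-- The duplicated team `X[M/x]`. -/
def Team.duplicate {M : Type w} {V : Finset ℕ} (X : Team M V) (x : ℕ) : Team M (insert x V) :=
  {s' | ∃ s ∈ X, ∃ m : M, s' = updateAt s x m}

/-- The relation `X(t₁ … t_k) = {(s(t₁), …, s(t_k)) : s ∈ X}`. -/
def Team.toRel {L : FirstOrder.Language.{u, v}} {M : Type w} [L.Structure M] {V : Finset ℕ} (X : Team M V)
    {k : ℕ} (ts : Fin k → L.Term V) : Set (Fin k → M) :=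
  {a | ∃ s ∈ X, a = fun i => (ts i).realize s}

/-- The satisfaction relation `M ⊨_X φ` of Team Semantics. -/
def Sat {L : FirstOrder.Language.{u, v}} {D : Set Dependency} {M : Type w} [L.Structure M] :
    {V : Finset ℕ} → Team M V → TeamFormula L D V → Prop
  | _, X, .eq t₁ t₂ => ∀ s ∈ X, t₁.realize s = t₂.realize s
  | _, X, .ne t₁ t₂ => ∀ s ∈ X, t₁.realize s ≠ t₂.realize s
  | _, X, .rel r ts => ∀ s ∈ X, Structure.RelMap r (fun i => (ts i).realize s)
  | _, X, .nrel r ts => ∀ s ∈ X, ¬ Structure.RelMap r (fun i => (ts i).realize s)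
  | _, X, .dep d _ ts => d.Holds (X.toRel ts)
  | _, X, .or φ ψ => ∃ Y Z : Team M _, X = Y ∪ Z ∧ Sat Y φ ∧ Sat Z ψ
  | _, X, .and φ ψ => Sat X φ ∧ Sat X ψ
  | _, X, .ex x φ => ∃ H : (_ → M) → Set M, (∀ s ∈ X, (H s).Nonempty) ∧ Sat (X.supplement x H) φ
  | _, X, .all x φ => Sat (X.duplicate x) φ

/-- The empty assignment `ε`. -/
def emptyAssignment (M : Type w) : ↥(∅ : Finset ℕ) → M :=
  fun y => absurd y.2 (Finset.notMem_empty y.1)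

/-- Truth of a sentence in a model: satisfaction by the team `{ε}`. -/
def TrueIn {L : FirstOrder.Language.{u, v}} {D : Set Dependency} (M : Type w) [L.Structure M]
    (φ : TeamSentence L D) : Prop :=
  Sat ({emptyAssignment M} : Team M ∅) φ

/-! ### Safety and definability

All models are assumed to have at least two elements. -/

/-- `E` is safe for `D`: over every signature, every sentence of `FO(E, D)` is equivalent to some
sentence of `FO(D)`. -/
def Safe (E D : Set Dependency) : Prop :=
  ∀ (L : FirstOrder.Language.{u, v}) (φ : TeamSentence L (E ∪ D)), ∃ φ' : TeamSentence L D,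
    ∀ (M : Type w) [L.Structure M] [Nontrivial M], TrueIn M φ ↔ TrueIn M φ'

/-- The dependency `d` is definable in `FO(D)`: for every tuple `x` of distinct variables, the atom
`d x` is equivalent to a formula of `FO(D)` over all teams with domain `x`. -/
def DefinableIn (d : Dependency) (D : Set Dependency) : Prop :=
  ∀ (L : FirstOrder.Language.{u, v}) (x : Fin d.arity → ℕ), Function.Injective x →
    ∃ ψ : TeamFormula L D (Finset.univ.image x),
      ∀ (M : Type w) [L.Structure M] [Nontrivial M] (X : Team M (Finset.univ.image x)),
        Sat X (TeamFormula.dep (L := L) (D := {d}) d (Set.mem_singleton d)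
          (fun i => Term.var ⟨x i, Finset.mem_image_of_mem x (Finset.mem_univ i)⟩)) ↔ Sat X ψ

/-! ### The dependencies of the statement -/

/-- The atomic formula `R t₁ … t_k` over the signature `{R}`. -/
def relAtom {k n : ℕ} (ts : Fin k → (relLang k).Term (Empty ⊕ Fin n)) :
    (relLang k).BoundedFormula Empty n :=
  Relations.boundedFormula (L := relLang k) (RelSymb.R : RelSymb k k) ts

/-- Totality, `∀ x (R x)`, for `k`-tuples `x`. -/
@[reducible] def totality (k : ℕ) : Dependency where
  arity := k
  sentence := (relAtom fun i : Fin k => Term.var (Sum.inr i)).alls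

/-- Non-constancy, `∃ x ∃ y (R x ∧ R y ∧ x ≠ y)`, for `k`-tuples `x` and `y`. -/
@[reducible] noncomputable def nonConstancy (k : ℕ) : Dependency where
  arity := k
  sentence :=
    let x : Fin k → (relLang k).Term (Empty ⊕ Fin (k + k)) :=
      fun i => Term.var (Sum.inr (Fin.castAdd k i))
    let y : Fin k → (relLang k).Term (Empty ⊕ Fin (k + k)) :=
      fun i => Term.var (Sum.inr (Fin.natAdd k i))
    (relAtom x ⊓ relAtom y ⊓ ∼(BoundedFormula.iInf fun i => (x i).bdEqual (y i))).exs

/-- Nonemptiness, `∃ x (R x)`, for `k`-tuples `x`. -/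
@[reducible] def nonEmptiness (k : ℕ) : Dependency where
  arity := k
  sentence := (relAtom fun i : Fin k => Term.var (Sum.inr i)).exs

/-- The totality dependencies `All` of all arities. -/
def All : Set Dependency := Set.range totality

/-- The non-constancy dependencies `NC` of all arities. -/
def NC : Set Dependency := Set.range nonConstancy

/-- The nonemptiness dependencies `NE` of all arities. -/
def NE : Set Dependency := Set.range nonEmptiness

end TeamSem

namespace TeamSem

open FirstOrder FirstOrder.Language

variable {L : FirstOrder.Language.{u, v}}

/-! ### The truth conditions of the dependencies -/

/-! Safety of `NC` is proved by removing one atom at a time. Non-constancy of `t` is witnessed by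
just two assignments, so these two can be tracked through the formula. A tuple `w`, guessed
existentially at the outside, holds the value of `t` at the first witness. Universally quantified
auxiliary variables split each assignment into copies, some carrying a flag `F₁`, some a flag `F₂`,
some neither. The atom becomes the flat condition (`F₁` → `t = w`) ∧ (`F₂` → `t ≠ w`), and the
connectives above it are adjusted so that flagged copies must reach it. Flagged copies follow the
two witnesses; unflagged copies reproduce the original team, so the other subformulas are
undisturbed. This invariant is `Eliminates`, proved by induction in `Eliminable.of_pos` and closed
off by `Eliminable.exists_sentence`.

Bound variables may clash with those in scope, so the new formula lives over a domain `W` with a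
renaming `f : V → W`, and quantifiers always bind fresh variables (`exists_isExtension`,
`exists_rename`).

Safety of `NE` reduces to that of `NC`, since nonemptiness of a team is `∀ v NC(v)` in models with
two elements. With totality atoms, nonemptiness is `∀ v All(v)` and non-constancy is `∀ w (w = t ∨
(w ≠ t ∧ All(w)))`. -/

theorem totality_holds {M : Type w} {k : ℕ} (S : Set (Fin k → M)) :
    (totality k).Holds S ↔ S = Set.univ := by
  let _ := relStructure S
  have h : (totality k).Holds S ↔ ∀ a : Fin k → M, a ∈ S := by
    change Formula.Realize _ _ ↔ _
    rw [BoundedFormula.realize_alls]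
    refine forall_congr' fun a => ?_
    rw [relAtom, BoundedFormula.realize_rel]
    rfl
  rw [h, Set.eq_univ_iff_forall]

theorem nonEmptiness_holds {M : Type w} {k : ℕ} (S : Set (Fin k → M)) :
    (nonEmptiness k).Holds S ↔ S.Nonempty := by
  let _ := relStructure S
  change Formula.Realize _ _ ↔ _
  rw [BoundedFormula.realize_exs]
  refine exists_congr fun a => ?_
  rw [relAtom, BoundedFormula.realize_rel]
  rfl

theorem nonConstancy_holds {M : Type w} {k : ℕ} (S : Set (Fin k → M)) :
    (nonConstancy k).Holds S ↔ S.Nontrivial := by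
  let _ := relStructure S
  have h : (nonConstancy k).Holds S ↔ ∃ xs : Fin (k + k) → M,
      ((fun i => xs (Fin.castAdd k i)) ∈ S ∧ (fun i => xs (Fin.natAdd k i)) ∈ S) ∧
        ¬ ∀ i : Fin k, xs (Fin.castAdd k i) = xs (Fin.natAdd k i) := by
    change Formula.Realize _ _ ↔ _
    rw [BoundedFormula.realize_exs]
    refine exists_congr fun a => ?_
    rw [BoundedFormula.realize_inf, BoundedFormula.realize_inf, BoundedFormula.realize_not,
      BoundedFormula.realize_iInf, relAtom, relAtom, BoundedFormula.realize_rel,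
      BoundedFormula.realize_rel]
    simp only [BoundedFormula.realize_bdEqual]
    rfl
  rw [h]
  constructor
  · rintro ⟨xs, ⟨h₁, h₂⟩, h₃⟩
    exact ⟨_, h₁, _, h₂, fun e => h₃ fun i => congrFun e i⟩
  · rintro ⟨a, ha, b, hb, hab⟩
    refine ⟨Fin.append a b, ⟨by simpa only [Fin.append_left] using ha,
      by simpa only [Fin.append_right] using hb⟩, fun e => hab ?_⟩
    funext i
    simpa only [Fin.append_left, Fin.append_right] using e i

theorem holds_of_mem_NC {d : Dependency} (hd : d ∈ NC) {M : Type w} (S : Set (Fin d.arity → M)) :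
    d.Holds S ↔ S.Nontrivial := by
  obtain ⟨k, rfl⟩ := hd
  exact nonConstancy_holds S

theorem holds_of_mem_NE {d : Dependency} (hd : d ∈ NE) {M : Type w} (S : Set (Fin d.arity → M)) :
    d.Holds S ↔ S.Nonempty := by
  obtain ⟨k, rfl⟩ := hd
  exact nonEmptiness_holds S

theorem toRel_nonempty {M : Type w} [L.Structure M] {V : Finset ℕ} {X : Team M V} {k : ℕ}
    {ts : Fin k → L.Term V} : (X.toRel ts).Nonempty ↔ X.Nonempty :=
  ⟨fun ⟨_, s, hs, _⟩ => ⟨s, hs⟩, fun ⟨s, hs⟩ => ⟨_, s, hs, rfl⟩⟩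

/-! ### Counting atoms, and translating atom by atom -/

/-- The number of occurrences in a formula of dependency atoms that do not belong to `D`. -/
noncomputable def atomsOutside (D : Set Dependency) {E : Set Dependency} :
    {V : Finset ℕ} → TeamFormula L E V → ℕ
  | _, .eq _ _ => 0
  | _, .ne _ _ => 0
  | _, .rel _ _ => 0
  | _, .nrel _ _ => 0
  | _, .dep d _ _ => open Classical in if d ∈ D then 0 else 1
  | _, .or φ ψ => atomsOutside D φ + atomsOutside D ψ
  | _, .and φ ψ => atomsOutside D φ + atomsOutside D ψ
  | _, .ex _ φ => atomsOutside D φ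
  | _, .all _ φ => atomsOutside D φ

theorem atomsOutside_self {E : Set Dependency} {V : Finset ℕ} (φ : TeamFormula L E V) :
    atomsOutside E φ = 0 := by
  induction φ <;> simp_all [atomsOutside]

/-- If the atoms of `E` that belong to `D` can be expressed in `FO(D')`, then so can every formula
of `FO(E)` with no other atoms. -/
theorem exists_translation {E D D' : Set Dependency}
    (h : ∀ (V : Finset ℕ) (d : Dependency) (hd : d ∈ E) (ts : Fin d.arity → L.Term V), d ∈ D →
      ∃ ψ : TeamFormula L D' V, ∀ (M : Type w) [L.Structure M] [Nontrivial M] (X : Team M V),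
        Sat X (TeamFormula.dep d hd ts) ↔ Sat X ψ)
    {V : Finset ℕ} (φ : TeamFormula L E V) (hφ : atomsOutside D φ = 0) :
    ∃ ψ : TeamFormula L D' V, ∀ (M : Type w) [L.Structure M] [Nontrivial M] (X : Team M V),
      Sat X φ ↔ Sat X ψ := by
  induction φ with
  | eq t₁ t₂ => exact ⟨.eq t₁ t₂, fun M _ _ X => Iff.rfl⟩
  | ne t₁ t₂ => exact ⟨.ne t₁ t₂, fun M _ _ X => Iff.rfl⟩
  | rel r ts => exact ⟨.rel r ts, fun M _ _ X => Iff.rfl⟩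
  | nrel r ts => exact ⟨.nrel r ts, fun M _ _ X => Iff.rfl⟩
  | dep d hd ts => exact h _ d hd ts (by simpa [atomsOutside] using hφ)
  | or φ ψ ih₁ ih₂ =>
    simp only [atomsOutside, Nat.add_eq_zero_iff] at hφ
    obtain ⟨φ', h₁⟩ := ih₁ hφ.1
    obtain ⟨ψ', h₂⟩ := ih₂ hφ.2
    exact ⟨.or φ' ψ', fun M _ _ X => by simp only [Sat, h₁, h₂]⟩
  | and φ ψ ih₁ ih₂ =>
    simp only [atomsOutside, Nat.add_eq_zero_iff] at hφ
    obtain ⟨φ', h₁⟩ := ih₁ hφ.1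
    obtain ⟨ψ', h₂⟩ := ih₂ hφ.2
    exact ⟨.and φ' ψ', fun M _ _ X => by simp only [Sat, h₁, h₂]⟩
  | ex x φ ih =>
    obtain ⟨φ', h'⟩ := ih hφ
    exact ⟨.ex x φ', fun M _ _ X => by simp only [Sat, h']⟩
  | all x φ ih =>
    obtain ⟨φ', h'⟩ := ih hφ
    exact ⟨.all x φ', fun M _ _ X => by simp only [Sat, h']⟩

/-! ### Quantification over fresh variables -/

/-- The team `{s ∘ f : s ∈ X}`. -/
def Team.pull {M : Type w} {V W : Finset ℕ} (f : V → W) (X : Team M W) : Team M V :=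
  (fun s => s ∘ f) '' X

theorem Team.pull_pull {M : Type w} {U V W : Finset ℕ} (f : U → V) (g : V → W) (X : Team M W) :
    (X.pull g).pull f = X.pull (g ∘ f) := by
  simp only [Team.pull, Set.image_image]
  rfl

theorem Team.pull_id {M : Type w} {V : Finset ℕ} (X : Team M V) : X.pull id = X := by
  simp [Team.pull]

theorem Team.pull_inter_preimage {M : Type w} {V W : Finset ℕ} {f : V → W} {X : Team M W}
    {Y : Team M V} (h : Y ⊆ X.pull f) : Team.pull f {s ∈ X | s ∘ f ∈ Y} = Y := by
  ext s
  constructor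
  · rintro ⟨s', ⟨_, hs'⟩, rfl⟩
    exact hs'
  · intro hs
    obtain ⟨s', hs', rfl⟩ := h hs
    exact ⟨s', ⟨hs', hs⟩, rfl⟩

/-- The domain `W'` extends `W`, via `ι`, by a tuple `w` of new variables, which can be quantified
existentially or universally in `FO(E)`. -/
structure IsExtension (L : FirstOrder.Language.{u, v}) (E D : Set Dependency) {W W' : Finset ℕ}
    {k : ℕ} (ι : W → W') (w : Fin k → W') : Prop where
  exists_extend : ∀ {M : Type w} (s : W → M) (m : Fin k → M), ∃ s' : W' → M, s' ∘ ι = s ∧ s' ∘ w = m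
  exists_ex : ∀ ψ : TeamFormula L E W', ∃ ψ' : TeamFormula L E W,
    atomsOutside D ψ' = atomsOutside D ψ ∧ ∀ (M : Type w) [L.Structure M] (X : Team M W),
      Sat X ψ' ↔ ∃ X' : Team M W', X'.pull ι = X ∧ Sat X' ψ
  exists_all : ∀ ψ : TeamFormula L E W', ∃ ψ' : TeamFormula L E W,
    atomsOutside D ψ' = atomsOutside D ψ ∧ ∀ (M : Type w) [L.Structure M] (X : Team M W),
      Sat X ψ' ↔ Sat ({s | s ∘ ι ∈ X} : Team M W') ψ

theorem updateAt_self {M : Type w} {V : Finset ℕ} (s : V → M) (x : ℕ) (m : M) :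
    updateAt s x m ⟨x, Finset.mem_insert_self x V⟩ = m := by
  simp [updateAt]

theorem exists_updateAt {M : Type w} {V : Finset ℕ} {x : ℕ} (s : ↥(insert x V) → M) :
    s = updateAt (fun y => s ⟨y.1, Finset.mem_insert_of_mem y.2⟩) x
      (s ⟨x, Finset.mem_insert_self x V⟩) := by
  funext y
  by_cases h : y.1 = x
  · obtain ⟨y, hy⟩ := y
    obtain rfl : y = x := h
    simp [updateAt]
  · simp [updateAt, h]

theorem updateAt_comp {M : Type w} {V : Finset ℕ} {x : ℕ} (hx : x ∉ V) (s : V → M) (m : M) :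
    updateAt s x m ∘ (fun y : V => (⟨y.1, Finset.mem_insert_of_mem y.2⟩ : ↥(insert x V))) = s := by
  funext y
  have : y.1 ≠ x := fun e => hx (e ▸ y.2)
  simp [updateAt, this]

/-- Since choice functions are set-valued and `x` is new, the teams `X[H/x]` are exactly the teams
that restrict to `X`. -/
theorem isExtension_insert (E D : Set Dependency) {W : Finset ℕ} {x : ℕ} (hx : x ∉ W) :
    IsExtension.{u, v, w} L E D
      (fun y : W => (⟨y.1, Finset.mem_insert_of_mem y.2⟩ : ↥(insert x W)))
      (fun _ : Fin 1 => ⟨x, Finset.mem_insert_self x W⟩) where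
  exists_extend s m := ⟨updateAt s x (m 0), updateAt_comp hx s _, by
    funext i
    rw [Subsingleton.elim i 0]
    exact updateAt_self s x _⟩
  exists_ex ψ := by
    refine ⟨.ex x ψ, rfl, fun M _ X => ?_⟩
    constructor
    · rintro ⟨H, hH, h⟩
      refine ⟨_, ?_, h⟩
      ext s
      constructor
      · rintro ⟨_, ⟨s', hs', m, _, rfl⟩, rfl⟩
        simpa only [updateAt_comp hx] using hs'
      · intro hs
        obtain ⟨m, hm⟩ := hH s hs
        exact ⟨_, ⟨s, hs, m, hm, rfl⟩, updateAt_comp hx s m⟩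
    · rintro ⟨X', rfl, h⟩
      refine ⟨fun s => {m | updateAt s x m ∈ X'}, ?_, ?_⟩
      · rintro _ ⟨s, hs, rfl⟩
        refine ⟨s ⟨x, Finset.mem_insert_self x W⟩, ?_⟩
        have := exists_updateAt s
        rw [this] at hs
        exact hs
      · convert h
        ext s
        constructor
        · rintro ⟨_, _, m, hm, rfl⟩
          exact hm
        · intro hs
          refine ⟨_, ⟨s, hs, rfl⟩, s ⟨x, Finset.mem_insert_self x W⟩, ?_, exists_updateAt s⟩
          have := exists_updateAt s
          rw [this] at hs
          exact hs
  exists_all ψ := by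
    refine ⟨.all x ψ, rfl, fun M _ X => ?_⟩
    change Sat (Team.duplicate X x) ψ ↔ _
    have : Team.duplicate X x = {s | s ∘ (fun y : W => (⟨y.1, Finset.mem_insert_of_mem y.2⟩ :
        ↥(insert x W))) ∈ X} := by
      ext s
      constructor
      · rintro ⟨s, hs, m, rfl⟩
        simpa only [Set.mem_ofPred_eq, updateAt_comp hx] using hs
      · intro hs
        exact ⟨_, hs, _, exists_updateAt s⟩
    rw [this]

/-- A fresh tuple of variables of any length can be adjoined to any domain. -/
theorem exists_isExtension (L : FirstOrder.Language.{u, v}) (E D : Set Dependency) (W : Finset ℕ)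
    (k : ℕ) : ∃ (W' : Finset ℕ) (ι : W → W') (w : Fin k → W'), IsExtension.{u, v, w} L E D ι w := by
  induction k with
  | zero =>
    refine ⟨W, id, Fin.elim0, ⟨fun s m => ⟨s, rfl, Subsingleton.elim _ _⟩,
      fun ψ => ⟨ψ, rfl, fun M _ X => ?_⟩, fun ψ => ⟨ψ, rfl, fun M _ X => Iff.rfl⟩⟩⟩
    simp [Team.pull_id]
  | succ k ih =>
    obtain ⟨W₁, ι₁, w₁, h₁⟩ := ih
    obtain ⟨x, hx⟩ := Infinite.exists_notMem_finset W₁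
    have h₂ := isExtension_insert.{u, v, w} (L := L) E D hx
    set ι₂ := fun y : W₁ => (⟨y.1, Finset.mem_insert_of_mem y.2⟩ : ↥(insert x W₁))
    set y : ↥(insert x W₁) := ⟨x, Finset.mem_insert_self x W₁⟩
    refine ⟨_, ι₂ ∘ ι₁, Fin.cons y (ι₂ ∘ w₁), ⟨fun s m => ?_, fun ψ => ?_, fun ψ => ?_⟩⟩
    · obtain ⟨s₁, hs₁, hm₁⟩ := h₁.exists_extend s (Fin.tail m)
      obtain ⟨s₂, hs₂, hm₂⟩ := h₂.exists_extend s₁ (fun _ => m 0)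
      refine ⟨s₂, by rw [← Function.comp_assoc, hs₂, hs₁], ?_⟩
      funext i
      refine Fin.cases ?_ (fun j => ?_) i
      · exact congrFun hm₂ 0
      · have e : s₂ (ι₂ (w₁ j)) = s₁ (w₁ j) := congrFun hs₂ _
        have e' : s₁ (w₁ j) = m j.succ := congrFun hm₁ j
        simp [e, e']
    · obtain ⟨ψ₂, c₂, e₂⟩ := h₂.exists_ex ψ
      obtain ⟨ψ₁, c₁, e₁⟩ := h₁.exists_ex ψ₂
      refine ⟨ψ₁, c₁.trans c₂, fun M _ X => ?_⟩
      rw [e₁]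
      constructor
      · rintro ⟨X₁, rfl, h⟩
        obtain ⟨X₂, rfl, h'⟩ := (e₂ M _).1 h
        exact ⟨X₂, (Team.pull_pull _ _ _).symm, h'⟩
      · rintro ⟨X₂, rfl, h⟩
        exact ⟨X₂.pull ι₂, Team.pull_pull _ _ _, (e₂ M _).2 ⟨X₂, rfl, h⟩⟩
    · obtain ⟨ψ₂, c₂, e₂⟩ := h₂.exists_all ψ
      obtain ⟨ψ₁, c₁, e₁⟩ := h₁.exists_all ψ₂
      exact ⟨ψ₁, c₁.trans c₂, fun M _ X => by rw [e₁, e₂]; rfl⟩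

/-! ### Renaming of variables -/

/-- The extension to `V ∪ {x}` of the renaming `f : V → W`, which maps `x` to `y`. -/
def renameInsert {V W : Finset ℕ} (f : V → W) (x : ℕ) (y : W) : ↥(insert x V) → W :=
  fun z => if h : z.1 = x then y else f ⟨z.1, Finset.mem_of_mem_insert_of_ne z.2 h⟩

theorem comp_renameInsert {M : Type w} {V W : Finset ℕ} (f : V → W) (x : ℕ) (y : W) (s : W → M) :
    s ∘ renameInsert f x y = updateAt (s ∘ f) x (s y) := by
  funext z
  by_cases h : z.1 = x <;> simp [renameInsert, updateAt, h]

theorem Team.pull_renameInsert {M : Type w} {V W : Finset ℕ} (f : V → W) (x : ℕ) (y : W)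
    (X : Team M W) : X.pull (renameInsert f x y) =
      (X.pull f).supplement x (fun s => {m | ∃ s' ∈ X, s' ∘ f = s ∧ s' y = m}) := by
  ext s
  constructor
  · rintro ⟨s, hs, rfl⟩
    exact ⟨s ∘ f, ⟨s, hs, rfl⟩, s y, ⟨s, hs, rfl, rfl⟩, comp_renameInsert f x y s⟩
  · rintro ⟨_, _, _, ⟨s, hs, rfl, rfl⟩, rfl⟩
    exact ⟨s, hs, comp_renameInsert f x y s⟩

theorem Team.nonempty_of_mem_pull {M : Type w} {V W : Finset ℕ} (f : V → W) (y : W) (X : Team M W) :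
    ∀ s ∈ X.pull f, {m | ∃ s' ∈ X, s' ∘ f = s ∧ s' y = m}.Nonempty := by
  rintro _ ⟨s, hs, rfl⟩
  exact ⟨s y, s, hs, rfl, rfl⟩

theorem Team.toRel_pull {M : Type w} [L.Structure M] {V W : Finset ℕ} (f : V → W) (X : Team M W)
    {k : ℕ} (ts : Fin k → L.Term V) :
    (X.pull f).toRel ts = X.toRel (fun i => (ts i).relabel f) := by
  ext a
  simp [Team.toRel, Team.pull]

/-- Variables can be renamed: the truth of a formula depends only on the values of its free
variables. -/
theorem exists_rename {E : Set Dependency} (D : Set Dependency) {V : Finset ℕ}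
    (φ : TeamFormula L E V) {W : Finset ℕ} (f : V → W) :
    ∃ φ' : TeamFormula L E W, atomsOutside D φ' = atomsOutside D φ ∧
      ∀ (M : Type w) [L.Structure M] (X : Team M W), Sat X φ' ↔ Sat (X.pull f) φ := by
  induction φ generalizing W with
  | eq t₁ t₂ =>
    exact ⟨.eq (t₁.relabel f) (t₂.relabel f), rfl, fun M _ X => by simp [Sat, Team.pull]⟩
  | ne t₁ t₂ =>
    exact ⟨.ne (t₁.relabel f) (t₂.relabel f), rfl, fun M _ X => by simp [Sat, Team.pull]⟩
  | rel r ts =>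
    exact ⟨.rel r fun i => (ts i).relabel f, rfl, fun M _ X => by simp [Sat, Team.pull]⟩
  | nrel r ts =>
    exact ⟨.nrel r fun i => (ts i).relabel f, rfl, fun M _ X => by simp [Sat, Team.pull]⟩
  | dep d hd ts =>
    exact ⟨.dep d hd fun i => (ts i).relabel f, rfl, fun M _ X => by
      simp only [Sat, Team.toRel_pull]⟩
  | and φ ψ ih₁ ih₂ =>
    obtain ⟨φ', c₁, h₁⟩ := ih₁ f
    obtain ⟨ψ', c₂, h₂⟩ := ih₂ f
    exact ⟨.and φ' ψ', by simp only [atomsOutside, c₁, c₂], fun M _ X => by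
      simp only [Sat, h₁, h₂]⟩
  | or φ ψ ih₁ ih₂ =>
    obtain ⟨φ', c₁, h₁⟩ := ih₁ f
    obtain ⟨ψ', c₂, h₂⟩ := ih₂ f
    refine ⟨.or φ' ψ', by simp only [atomsOutside, c₁, c₂], fun M _ X => ?_⟩
    simp only [Sat, h₁, h₂]
    constructor
    · rintro ⟨Y, Z, rfl, hY, hZ⟩
      exact ⟨_, _, Set.image_union _ _ _, hY, hZ⟩
    · rintro ⟨Y, Z, e, hY, hZ⟩
      -- The two parts of a split may overlap, so preimages of `Y` and `Z` can be used as they are.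
      refine ⟨{s ∈ X | s ∘ f ∈ Y}, {s ∈ X | s ∘ f ∈ Z}, ?_, ?_, ?_⟩
      · ext s
        constructor
        · intro hs
          have : s ∘ f ∈ Y ∪ Z := e ▸ ⟨s, hs, rfl⟩
          exact this.imp (fun h => ⟨hs, h⟩) (fun h => ⟨hs, h⟩)
        · rintro (h | h) <;> exact h.1
      · rwa [Team.pull_inter_preimage (e ▸ Set.subset_union_left)]
      · rwa [Team.pull_inter_preimage (e ▸ Set.subset_union_right)]
  | @ex V x φ ih =>
    -- The bound variable `x` is replaced by a fresh `y 0`, so that no value in `W` is overwritten.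
    obtain ⟨W', ι, y, h⟩ := exists_isExtension.{u, v, w} L E D W 1
    obtain ⟨φ₁, c₁, h₁⟩ := ih (renameInsert (ι ∘ f) x (y 0))
    obtain ⟨φ₂, c₂, h₂⟩ := h.exists_ex φ₁
    refine ⟨φ₂, c₂.trans c₁, fun M _ X => ?_⟩
    simp only [h₂, h₁, Team.pull_renameInsert, ← Team.pull_pull]
    constructor
    · rintro ⟨X', rfl, hX'⟩
      refine ⟨_, ?_, hX'⟩
      rw [Team.pull_pull]
      exact Team.nonempty_of_mem_pull _ _ _
    · rintro ⟨H, hH, hX⟩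
      have e : Team.pull ι {s : W' → M | s ∘ ι ∈ X ∧ s (y 0) ∈ H ((s ∘ ι) ∘ f)} = X := by
        ext s
        constructor
        · rintro ⟨s, hs, rfl⟩
          exact hs.1
        · intro hs
          obtain ⟨m, hm⟩ := hH _ ⟨s, hs, rfl⟩
          obtain ⟨s', rfl, hm'⟩ := h.exists_extend s (fun _ => m)
          refine ⟨s', ⟨hs, ?_⟩, rfl⟩
          rwa [show s' (y 0) = m from congrFun hm' 0]
      refine ⟨_, e, ?_⟩
      convert hX using 1
      rw [e]
      ext s
      constructor
      · rintro ⟨_, hs, _, ⟨s', hs', rfl, rfl⟩, rfl⟩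
        exact ⟨_, hs, _, hs'.2, rfl⟩
      · rintro ⟨_, ⟨s, hs, rfl⟩, m, hm, rfl⟩
        obtain ⟨s', rfl, hm'⟩ := h.exists_extend s (fun _ => m)
        have hm' : s' (y 0) = m := congrFun hm' 0
        exact ⟨_, ⟨_, hs, rfl⟩, m, ⟨s', ⟨hs, by rwa [hm']⟩, rfl, hm'⟩, rfl⟩
  | @all V x φ ih =>
    obtain ⟨W', ι, y, h⟩ := exists_isExtension.{u, v, w} L E D W 1
    obtain ⟨φ₁, c₁, h₁⟩ := ih (renameInsert (ι ∘ f) x (y 0))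
    obtain ⟨φ₂, c₂, h₂⟩ := h.exists_all φ₁
    refine ⟨φ₂, c₂.trans c₁, fun M _ X => ?_⟩
    rw [h₂, h₁]
    change _ ↔ Sat (Team.duplicate (X.pull f) x) φ
    have e : Team.pull (renameInsert (ι ∘ f) x (y 0)) {s : W' → M | s ∘ ι ∈ X} =
        Team.duplicate (X.pull f) x := by
      ext s
      constructor
      · rintro ⟨s, hs, rfl⟩
        exact ⟨_, ⟨_, hs, rfl⟩, _, comp_renameInsert _ _ _ _⟩
      · rintro ⟨_, ⟨s, hs, rfl⟩, m, rfl⟩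
        obtain ⟨s', rfl, hm'⟩ := h.exists_extend s (fun _ => m)
        have hm' : s' (y 0) = m := congrFun hm' 0
        subst hm'
        exact ⟨s', hs, comp_renameInsert _ _ _ _⟩
    rw [e]

/-! ### Flat conditions -/

/-- The condition `P` on assignments is expressed by a formula with no atoms outside `D` that a
team satisfies if and only if all its assignments satisfy `P`. -/
def FlatDefinable (L : FirstOrder.Language.{u, v}) (E D : Set Dependency) {W : Finset ℕ}
    (P : ∀ (M : Type w) [L.Structure M], (W → M) → Prop) : Prop :=
  ∃ φ : TeamFormula L E W, atomsOutside D φ = 0 ∧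
    ∀ (M : Type w) [L.Structure M] [Nontrivial M] (X : Team M W), Sat X φ ↔ ∀ s ∈ X, P M s

namespace FlatDefinable

variable {E D : Set Dependency} {W : Finset ℕ}
  {P Q : ∀ (M : Type w) [L.Structure M], (W → M) → Prop}

theorem congr (hP : FlatDefinable L E D P)
    (h : ∀ (M : Type w) [L.Structure M] (s : W → M), P M s ↔ Q M s) : FlatDefinable L E D Q := by
  obtain ⟨φ, c, hφ⟩ := hP
  exact ⟨φ, c, fun M _ _ X => by simp only [hφ, h]⟩

theorem eq (t₁ t₂ : L.Term W) :
    FlatDefinable L E D (fun (_ : Type w) _ s => t₁.realize s = t₂.realize s) :=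
  ⟨.eq t₁ t₂, rfl, fun _ _ _ _ => Iff.rfl⟩

theorem ne (t₁ t₂ : L.Term W) :
    FlatDefinable L E D (fun (_ : Type w) _ s => t₁.realize s ≠ t₂.realize s) :=
  ⟨.ne t₁ t₂, rfl, fun _ _ _ _ => Iff.rfl⟩

theorem and (hP : FlatDefinable L E D P) (hQ : FlatDefinable L E D Q) :
    FlatDefinable L E D (fun M _ s => P M s ∧ Q M s) := by
  obtain ⟨φ, c, hφ⟩ := hP
  obtain ⟨ψ, c', hψ⟩ := hQ
  refine ⟨.and φ ψ, by simp only [atomsOutside, c, c'], fun M _ _ X => ?_⟩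
  simp only [Sat, hφ, hψ, forall_and]

theorem or (hP : FlatDefinable L E D P) (hQ : FlatDefinable L E D Q) :
    FlatDefinable L E D (fun M _ s => P M s ∨ Q M s) := by
  obtain ⟨φ, c, hφ⟩ := hP
  obtain ⟨ψ, c', hψ⟩ := hQ
  refine ⟨.or φ ψ, by simp only [atomsOutside, c, c'], fun M _ _ X => ?_⟩
  simp only [Sat, hφ, hψ]
  constructor
  · rintro ⟨Y, Z, rfl, hY, hZ⟩ s (hs | hs)
    · exact Or.inl (hY s hs)
    · exact Or.inr (hZ s hs)
  · intro h
    refine ⟨{s ∈ X | P M s}, {s ∈ X | Q M s}, ?_, fun s hs => hs.2, fun s hs => hs.2⟩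
    ext s
    constructor
    · intro hs
      exact (h s hs).imp (fun h => ⟨hs, h⟩) (fun h => ⟨hs, h⟩)
    · rintro (h | h) <;> exact h.1

theorem rename (hP : FlatDefinable L E D P) {W' : Finset ℕ} (f : W → W') :
    FlatDefinable L E D (fun M _ (s : W' → M) => P M (s ∘ f)) := by
  obtain ⟨φ, c, hφ⟩ := hP
  obtain ⟨φ', c', hφ'⟩ := exists_rename.{u, v, w} D φ f
  refine ⟨φ', c'.trans c, fun M _ _ X => ?_⟩
  rw [hφ', hφ]
  exact Set.forall_mem_image

theorem true : FlatDefinable L E D (fun (M : Type w) _ (_ : W → M) => True) := by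
  -- The quantifier supplies a variable, as `W` may be empty and `L` may have no constants.
  refine ⟨.all 0 (.eq (.var ⟨0, Finset.mem_insert_self 0 W⟩) (.var ⟨0, Finset.mem_insert_self 0 W⟩)),
    rfl, fun M _ _ X => ?_⟩
  simp [Sat]

theorem false : FlatDefinable L E D (fun (M : Type w) _ (_ : W → M) => False) := by
  refine ⟨.all 0 (.ne (.var ⟨0, Finset.mem_insert_self 0 W⟩) (.var ⟨0, Finset.mem_insert_self 0 W⟩)),
    rfl, fun M _ _ X => ?_⟩
  constructor
  · intro h s hs
    obtain ⟨m, -⟩ := exists_pair_ne M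
    exact h _ ⟨s, hs, m, rfl⟩ rfl
  · rintro h _ ⟨s, hs, _⟩
    exact (h s hs).elim

theorem tuple_eq {k : ℕ} (t₁ t₂ : Fin k → L.Term W) :
    FlatDefinable L E D (fun (_ : Type w) _ s => ∀ i, (t₁ i).realize s = (t₂ i).realize s) := by
  induction k with
  | zero => exact true.congr fun M _ s => by simp
  | succ k ih =>
    exact ((eq (t₁ 0) (t₂ 0)).and (ih (Fin.tail t₁) (Fin.tail t₂))).congr fun M _ s => by
      simp [Fin.forall_fin_succ, Fin.tail]

theorem tuple_ne {k : ℕ} (t₁ t₂ : Fin k → L.Term W) :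
    FlatDefinable L E D (fun (_ : Type w) _ s => ¬ ∀ i, (t₁ i).realize s = (t₂ i).realize s) := by
  induction k with
  | zero => exact false.congr fun M _ s => by simp
  | succ k ih =>
    exact ((ne (t₁ 0) (t₂ 0)).or (ih (Fin.tail t₁) (Fin.tail t₂))).congr fun M _ s => by
      simp [Fin.forall_fin_succ, Fin.tail, imp_iff_not_or]

end FlatDefinable

/-! ### Elimination of a non-constancy atom -/

/-- The conditions `F₁` and `F₂` on assignments, called flags, are incompatible, and they and their
negations are flat. -/
structure IsFlagPair (L : FirstOrder.Language.{u, v}) (E D : Set Dependency) {W : Finset ℕ}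
    (F₁ F₂ : ∀ M : Type w, (W → M) → Prop) : Prop where
  flat₁ : FlatDefinable L E D (fun M _ s => F₁ M s)
  flat₂ : FlatDefinable L E D (fun M _ s => F₂ M s)
  flat_not₁ : FlatDefinable L E D (fun M _ s => ¬ F₁ M s)
  flat_not₂ : FlatDefinable L E D (fun M _ s => ¬ F₂ M s)
  disjoint : ∀ {M : Type w} {s : W → M}, F₁ M s → ¬ F₂ M s

theorem IsFlagPair.rename {E D : Set Dependency} {W W' : Finset ℕ}
    {F₁ F₂ : ∀ M : Type w, (W → M) → Prop} (hF : IsFlagPair L E D F₁ F₂) (f : W → W') :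
    IsFlagPair L E D (fun M s => F₁ M (s ∘ f)) (fun M s => F₂ M (s ∘ f)) :=
  ⟨hF.flat₁.rename f, hF.flat₂.rename f, hF.flat_not₁.rename f, hF.flat_not₂.rename f,
    fun h => hF.disjoint h⟩

theorem IsFlagPair.and_eq {E D : Set Dependency} {W : Finset ℕ}
    {F₁ F₂ : ∀ M : Type w, (W → M) → Prop} (hF : IsFlagPair L E D F₁ F₂) (a b : W) :
    IsFlagPair L E D (fun M s => F₁ M s ∧ s a = s b) (fun M s => F₂ M s ∧ s a = s b) :=
  ⟨hF.flat₁.and (.eq (.var a) (.var b)), hF.flat₂.and (.eq (.var a) (.var b)),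
    (hF.flat_not₁.or (.ne (.var a) (.var b))).congr fun M _ s => by
      simp [imp_iff_not_or],
    (hF.flat_not₂.or (.ne (.var a) (.var b))).congr fun M _ s => by
      simp [imp_iff_not_or],
    fun h h' => hF.disjoint h.1 h'.1⟩

/-- `φ'` eliminates a non-constancy atom from `φ`, given flags `F₁` and `F₂` and a tuple `w` of
variables: the two flags mark the assignments that witness non-constancy, and `w` holds the value
that is taken at the first witness and not at the second one. -/
structure Eliminates {E : Set Dependency} {V W : Finset ℕ} (φ : TeamFormula L E V)
    (φ' : TeamFormula L E W) (f : V → W) {k : ℕ} (w : Fin k → W)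
    (F₁ F₂ : ∀ M : Type w, (W → M) → Prop) : Prop where
  -- The two flagged assignments must agree on `w`, because an existentially quantified `w` may take
  -- several values in the team.
  sound : ∀ (M : Type w) [L.Structure M] [Nontrivial M] (X' : Team M W),
    (∃ s₁ ∈ X', ∃ s₂ ∈ X', F₁ M s₁ ∧ F₂ M s₂ ∧ s₁ ∘ w = s₂ ∘ w) → Sat X' φ' → Sat (X'.pull f) φ
  -- The witnesses and the value `a` depend on `X` alone. The two conditions on `X'` say that
  -- flagged copies lie over the witnesses, and that the unflagged ones already cover `X`; together
  -- they give `X'.pull f = X`.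
  complete : ∀ (M : Type w) [L.Structure M] [Nontrivial M] (X : Team M V), Sat X φ →
    ∃ s₁ ∈ X, ∃ s₂ ∈ X, ∃ a : Fin k → M, ∀ X' : Team M W,
      (∀ s ∈ X', s ∘ f ∈ X ∧ s ∘ w = a ∧ (F₁ M s → s ∘ f = s₁) ∧ (F₂ M s → s ∘ f = s₂)) →
      (∀ s ∈ X, ∃ s' ∈ X', s' ∘ f = s ∧ ¬ F₁ M s' ∧ ¬ F₂ M s') → Sat X' φ'

/-- One atom outside `D` can be eliminated from `φ`, over any domain. -/
def Eliminable (D : Set Dependency) {E : Set Dependency} {V : Finset ℕ} (φ : TeamFormula L E V) :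
    Prop :=
  ∃ k : ℕ, ∀ {W : Finset ℕ} (f : V → W) (w : Fin k → W) (F₁ F₂ : ∀ M : Type w, (W → M) → Prop),
    IsFlagPair L E D F₁ F₂ → ∃ φ' : TeamFormula L E W,
      atomsOutside D φ' + 1 = atomsOutside D φ ∧ Eliminates φ φ' f w F₁ F₂

namespace Eliminable

variable {D E : Set Dependency} {V : Finset ℕ}

theorem congr {φ ψ : TeamFormula L E V} (h : Eliminable.{u, v, w} D φ)
    (hc : atomsOutside D φ = atomsOutside D ψ)
    (he : ∀ (M : Type w) [L.Structure M] (X : Team M V), Sat X φ ↔ Sat X ψ) :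
    Eliminable.{u, v, w} D ψ := by
  obtain ⟨k, h⟩ := h
  refine ⟨k, fun f w F₁ F₂ hF => ?_⟩
  obtain ⟨φ', c, h'⟩ := h f w F₁ F₂ hF
  exact ⟨φ', c.trans hc, ⟨fun M _ _ X' hX' hs => (he _ _).1 (h'.sound M X' hX' hs),
    fun M _ _ X hX => h'.complete M X ((he _ _).2 hX)⟩⟩

theorem dep {d : Dependency} (hd : d ∈ E) (hD : d ∉ D) (hN : d ∈ NC)
    (ts : Fin d.arity → L.Term V) : Eliminable.{u, v, w} D (TeamFormula.dep d hd ts) := by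
  refine ⟨d.arity, fun {W} f w F₁ F₂ hF => ?_⟩
  -- The atom becomes (`F₁` → `t = w`) ∧ (`F₂` → `t ≠ w`).
  obtain ⟨φ', c, h⟩ := (hF.flat_not₁.or (FlatDefinable.tuple_eq (fun i => (ts i).relabel f)
    fun i => .var (w i))).and (hF.flat_not₂.or (FlatDefinable.tuple_ne
      (fun i => (ts i).relabel f) fun i => .var (w i)))
  refine ⟨φ', by simp [atomsOutside, c, hD], ⟨fun M _ _ X' hX' hs => ?_, fun M _ _ X hX => ?_⟩⟩
  · obtain ⟨s₁, hs₁, s₂, hs₂, hF₁, hF₂, he⟩ := hX'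
    rw [h] at hs
    have h₁ := (hs s₁ hs₁).1.resolve_left (not_not_intro hF₁)
    have h₂ := (hs s₂ hs₂).2.resolve_left (not_not_intro hF₂)
    simp only [Term.realize_relabel, Term.realize_var] at h₁ h₂
    refine (holds_of_mem_NC hN _).2 ⟨_, ⟨_, ⟨s₁, hs₁, rfl⟩, rfl⟩, _, ⟨_, ⟨s₂, hs₂, rfl⟩, rfl⟩,
      fun e => h₂ fun i => ?_⟩
    exact (congrFun e i).symm.trans ((h₁ i).trans (congrFun he i))
  · obtain ⟨_, ⟨s₁, hs₁, rfl⟩, _, ⟨s₂, hs₂, rfl⟩, hne⟩ := (holds_of_mem_NC hN _).1 hX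
    refine ⟨s₁, hs₁, s₂, hs₂, fun i => (ts i).realize s₁, fun X' hX' _ => ?_⟩
    rw [h]
    intro s hs
    obtain ⟨-, hw, h₁, h₂⟩ := hX' s hs
    simp only [Term.realize_relabel, Term.realize_var]
    refine ⟨imp_iff_not_or.1 fun hF₁ i => ?_, imp_iff_not_or.1 fun hF₂ he => hne ?_⟩
    · rw [h₁ hF₁]
      exact (congrFun hw i).symm
    · funext i
      rw [← h₂ hF₂, he i]
      exact (congrFun hw i).symm

theorem and_left {φ : TeamFormula L E V} (h : Eliminable.{u, v, w} D φ) (ψ : TeamFormula L E V) :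
    Eliminable.{u, v, w} D (φ.and ψ) := by
  obtain ⟨k, h⟩ := h
  refine ⟨k, fun f w F₁ F₂ hF => ?_⟩
  obtain ⟨φ', c, h'⟩ := h f w F₁ F₂ hF
  obtain ⟨ψ', c', hψ⟩ := exists_rename.{u, v, w} D ψ f
  refine ⟨.and φ' ψ', by simp only [atomsOutside]; omega, ⟨fun M _ _ X' hX' hs => ?_,
    fun M _ _ X hX => ?_⟩⟩
  · exact ⟨h'.sound M X' hX' hs.1, (hψ M X').1 hs.2⟩
  · obtain ⟨s₁, hs₁, s₂, hs₂, a, ha⟩ := h'.complete M X hX.1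
    refine ⟨s₁, hs₁, s₂, hs₂, a, fun X' h₁ h₂ => ⟨ha X' h₁ h₂, (hψ M X').2 ?_⟩⟩
    convert hX.2
    ext s
    constructor
    · rintro ⟨s', hs', rfl⟩
      exact (h₁ s' hs').1
    · intro hs
      obtain ⟨s', hs', e, -⟩ := h₂ s hs
      exact ⟨s', hs', e⟩

theorem and_right {ψ : TeamFormula L E V} (h : Eliminable.{u, v, w} D ψ) (φ : TeamFormula L E V) :
    Eliminable.{u, v, w} D (φ.and ψ) :=
  (h.and_left φ).congr (Nat.add_comm _ _) fun M _ X => by simp only [Sat, and_comm]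

/-- Flagged assignments must go to the disjunct containing the atom, so the other disjunct is
guarded by ¬`F₁` ∧ ¬`F₂`. It loses nothing, since unflagged copies cover its part of the team. -/
theorem or_left {φ : TeamFormula L E V} (h : Eliminable.{u, v, w} D φ) (ψ : TeamFormula L E V) :
    Eliminable.{u, v, w} D (φ.or ψ) := by
  obtain ⟨k, h⟩ := h
  refine ⟨k, fun f w F₁ F₂ hF => ?_⟩
  obtain ⟨φ', c, h'⟩ := h f w F₁ F₂ hF
  obtain ⟨ψ', c', hψ⟩ := exists_rename.{u, v, w} D ψ f
  obtain ⟨θ, cθ, hθ⟩ := hF.flat_not₁.and hF.flat_not₂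
  refine ⟨.or φ' (.and θ ψ'), by simp only [atomsOutside]; omega, ⟨?_, fun M _ _ X hX => ?_⟩⟩
  · rintro M _ _ _ ⟨s₁, hs₁, s₂, hs₂, h₁, h₂, he⟩ ⟨Y, Z, rfl, hY, hZ, hZ'⟩
    rw [hθ] at hZ
    refine ⟨Y.pull f, Z.pull f, Set.image_union _ _ _, h'.sound M Y ?_ hY, (hψ M Z).1 hZ'⟩
    exact ⟨s₁, hs₁.resolve_right fun h => (hZ s₁ h).1 h₁, s₂,
      hs₂.resolve_right fun h => (hZ s₂ h).2 h₂, h₁, h₂, he⟩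
  · obtain ⟨Y, Z, rfl, hY, hZ⟩ := hX
    obtain ⟨s₁, hs₁, s₂, hs₂, a, ha⟩ := h'.complete M Y hY
    refine ⟨s₁, Or.inl hs₁, s₂, Or.inl hs₂, a, fun X' h₁ h₂ => ?_⟩
    refine ⟨{s ∈ X' | s ∘ f ∈ Y}, {s ∈ X' | s ∘ f ∈ Z ∧ ¬ F₁ M s ∧ ¬ F₂ M s}, ?_,
      ha _ (fun s hs => ⟨hs.2, (h₁ s hs.1).2⟩) fun s hs => ?_, (hθ M _).2 fun s hs => hs.2.2,
      (hψ M _).2 ?_⟩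
    · ext s
      constructor
      · intro hs
        obtain ⟨hs', -, hs₁', hs₂'⟩ := h₁ s hs
        by_cases hF₁ : F₁ M s
        · exact Or.inl ⟨hs, hs₁' hF₁ ▸ hs₁⟩
        by_cases hF₂ : F₂ M s
        · exact Or.inl ⟨hs, hs₂' hF₂ ▸ hs₂⟩
        exact hs'.imp (fun h => ⟨hs, h⟩) (fun h => ⟨hs, h, hF₁, hF₂⟩)
      · rintro (h | h) <;> exact h.1
    · obtain ⟨s', hs', rfl, h'⟩ := h₂ s (Or.inl hs)
      exact ⟨s', ⟨hs', hs⟩, rfl, h'⟩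
    · convert hZ
      ext s
      constructor
      · rintro ⟨s', hs', rfl⟩
        exact hs'.2.1
      · intro hs
        obtain ⟨s', hs', rfl, h'⟩ := h₂ s (Or.inr hs)
        exact ⟨s', ⟨hs', hs, h'⟩, rfl⟩

theorem or_right {ψ : TeamFormula L E V} (h : Eliminable.{u, v, w} D ψ) (φ : TeamFormula L E V) :
    Eliminable.{u, v, w} D (φ.or ψ) :=
  (h.or_left φ).congr (Nat.add_comm _ _) fun M _ X => by
    constructor <;> rintro ⟨Y, Z, rfl, hY, hZ⟩ <;> exact ⟨Z, Y, Set.union_comm _ _, hZ, hY⟩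

theorem ex {x : ℕ} {φ : TeamFormula L E (insert x V)} (h : Eliminable.{u, v, w} D φ) :
    Eliminable.{u, v, w} D (TeamFormula.ex x φ) := by
  obtain ⟨k, h⟩ := h
  refine ⟨k, fun {W} f w F₁ F₂ hF => ?_⟩
  obtain ⟨W', ι, y, hι⟩ := exists_isExtension.{u, v, w} L E D W 1
  obtain ⟨φ₁, c₁, h₁⟩ := h (renameInsert (ι ∘ f) x (y 0)) (ι ∘ w) _ _ (hF.rename ι)
  obtain ⟨φ₂, c₂, h₂⟩ := hι.exists_ex φ₁
  refine ⟨φ₂, by simp only [atomsOutside]; omega, ⟨?_, fun M _ _ X hX => ?_⟩⟩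
  · rintro M _ _ X' ⟨s₁, hs₁, s₂, hs₂, hF₁, hF₂, he⟩ hs
    obtain ⟨X₁, rfl, hX₁⟩ := (h₂ M _).1 hs
    obtain ⟨s₁, hs₁, rfl⟩ := hs₁
    obtain ⟨s₂, hs₂, rfl⟩ := hs₂
    have := h₁.sound M X₁ ⟨s₁, hs₁, s₂, hs₂, hF₁, hF₂, he⟩ hX₁
    rw [Team.pull_renameInsert, ← Team.pull_pull] at this
    refine ⟨_, ?_, this⟩
    rw [Team.pull_pull]
    exact Team.nonempty_of_mem_pull _ _ _
  · obtain ⟨H, hH, hX⟩ := hX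
    obtain ⟨_, ⟨s₁, hs₁, m₁, hm₁, rfl⟩, _, ⟨s₂, hs₂, m₂, hm₂, rfl⟩, a, ha⟩ := h₁.complete M _ hX
    -- Flagged copies take the single value `m₁` or `m₂` of their witness; unflagged ones take all
    -- the values allowed by `H`.
    refine ⟨s₁, hs₁, s₂, hs₂, a, fun X' hX₁ hX₂ => (h₂ M X').2 ⟨{s | s ∘ ι ∈ X' ∧
      (F₁ M (s ∘ ι) → s (y 0) = m₁) ∧ (F₂ M (s ∘ ι) → s (y 0) = m₂) ∧
      (¬ F₁ M (s ∘ ι) → ¬ F₂ M (s ∘ ι) → s (y 0) ∈ H (s ∘ ι ∘ f))}, ?_, ha _ ?_ ?_⟩⟩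
    · ext s
      constructor
      · rintro ⟨s, hs, rfl⟩
        exact hs.1
      · intro hs
        have : ∃ m, (F₁ M s → m = m₁) ∧ (F₂ M s → m = m₂) ∧
            (¬ F₁ M s → ¬ F₂ M s → m ∈ H (s ∘ f)) := by
          by_cases hF₁ : F₁ M s
          · exact ⟨m₁, fun _ => rfl, fun h => (hF.disjoint hF₁ h).elim, fun h => (h hF₁).elim⟩
          by_cases hF₂ : F₂ M s
          · exact ⟨m₂, fun h => (hF₁ h).elim, fun _ => rfl, fun _ h => (h hF₂).elim⟩
          obtain ⟨m, hm⟩ := hH _ (hX₁ s hs).1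
          exact ⟨m, fun h => (hF₁ h).elim, fun h => (hF₂ h).elim, fun _ _ => hm⟩
        obtain ⟨m, hm⟩ := this
        obtain ⟨s', rfl, hm'⟩ := hι.exists_extend s (fun _ => m)
        obtain rfl : s' (y 0) = m := congrFun hm' 0
        exact ⟨s', ⟨hs, hm⟩, rfl⟩
    · rintro s ⟨hs, hm⟩
      obtain ⟨hsX, hw, e₁, e₂⟩ := hX₁ _ hs
      rw [comp_renameInsert]
      refine ⟨⟨_, hsX, _, ?_, rfl⟩, hw, fun hF₁ => ?_, fun hF₂ => ?_⟩
      · by_cases hF₁ : F₁ M (s ∘ ι)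
        · rw [e₁ hF₁, hm.1 hF₁]
          exact hm₁
        by_cases hF₂ : F₂ M (s ∘ ι)
        · rw [e₂ hF₂, hm.2.1 hF₂]
          exact hm₂
        exact hm.2.2 hF₁ hF₂
      · rw [hm.1 hF₁, ← e₁ hF₁]
        rfl
      · rw [hm.2.1 hF₂, ← e₂ hF₂]
        rfl
    · rintro _ ⟨s, hs, m, hm, rfl⟩
      obtain ⟨s', hs', rfl, hF₁, hF₂⟩ := hX₂ s hs
      obtain ⟨s', rfl, hm'⟩ := hι.exists_extend s' (fun _ => m)
      obtain rfl : s' (y 0) = m := congrFun hm' 0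
      exact ⟨s', ⟨hs', fun h => (hF₁ h).elim, fun h => (hF₂ h).elim, fun _ _ => hm⟩,
        comp_renameInsert _ _ _ _, hF₁, hF₂⟩

/-- A plain universal quantifier would give flagged assignments every value of `x`, whereas a
witness has only one. Hence `∀ x φ` becomes `∀ r₀ r₁ ∃ y (θ ∧ φ₁)`: copies with `r₀ = r₁` keep their
flags and choose `y` freely, while all other copies are unflagged and have `y = r₀`. As `M` has two
elements, each value of `r₀` occurs with some `r₁ ≠ r₀`, so the unflagged copies still range over
all of `M`. -/
theorem all {x : ℕ} {φ : TeamFormula L E (insert x V)} (h : Eliminable.{u, v, w} D φ) :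
    Eliminable.{u, v, w} D (TeamFormula.all x φ) := by
  obtain ⟨k, h⟩ := h
  refine ⟨k, fun {W} f w F₁ F₂ hF => ?_⟩
  obtain ⟨W₁, ι₁, r, hι₁⟩ := exists_isExtension.{u, v, w} L E D W 2
  obtain ⟨W₂, ι₂, y, hι₂⟩ := exists_isExtension.{u, v, w} L E D W₁ 1
  have hF' := ((hF.rename ι₁).rename ι₂).and_eq (ι₂ (r 0)) (ι₂ (r 1))
  obtain ⟨φ₁, c₁, h₁⟩ := h (renameInsert (ι₂ ∘ ι₁ ∘ f) x (y 0)) (ι₂ ∘ ι₁ ∘ w) _ _ hF'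
  obtain ⟨θ, cθ, hθ⟩ := (hF'.flat₁.or hF'.flat₂).or (.eq (.var (y 0)) (.var (ι₂ (r 0))))
  obtain ⟨φ₂, c₂, h₂⟩ := hι₂.exists_ex (.and θ φ₁)
  obtain ⟨φ₃, c₃, h₃⟩ := hι₁.exists_all φ₂
  refine ⟨φ₃, by simp only [atomsOutside] at c₂ ⊢; omega, ⟨?_, fun M _ _ X hX => ?_⟩⟩
  · rintro M _ _ X' ⟨s₁, hs₁, s₂, hs₂, hF₁, hF₂, he⟩ hs
    obtain ⟨X₂, hX₂, hX₂θ, hX₂φ⟩ := (h₂ M _).1 ((h₃ M _).1 hs)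
    rw [hθ] at hX₂θ
    obtain ⟨m₀, -⟩ := exists_pair_ne M
    have lift : ∀ s ∈ X', ∀ b : Fin 2 → M, ∃ s' ∈ X₂, s' ∘ ι₂ ∘ ι₁ = s ∧ s' ∘ ι₂ ∘ r = b := by
      intro s hs b
      obtain ⟨s', rfl, rfl⟩ := hι₁.exists_extend s b
      obtain ⟨s', hs', rfl⟩ : s' ∈ X₂.pull ι₂ := by
        rw [hX₂]
        exact hs
      exact ⟨s', hs', rfl, rfl⟩
    -- Taking `r₀ = r₁ = m₀` preserves the flag.
    obtain ⟨t₁, ht₁, rfl, hr₁⟩ := lift s₁ hs₁ fun _ => m₀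
    obtain ⟨t₂, ht₂, rfl, hr₂⟩ := lift s₂ hs₂ fun _ => m₀
    have := h₁.sound M X₂ ⟨t₁, ht₁, t₂, ht₂,
      ⟨hF₁, (congrFun hr₁ 0).trans (congrFun hr₁ 1).symm⟩,
      ⟨hF₂, (congrFun hr₂ 0).trans (congrFun hr₂ 1).symm⟩, he⟩ hX₂φ
    change Sat (Team.duplicate (X'.pull f) x) φ
    convert this using 1
    ext s
    constructor
    · rintro ⟨_, ⟨s, hs, rfl⟩, m, rfl⟩
      obtain ⟨m', hm'⟩ := exists_ne m
      obtain ⟨t, ht, rfl, hr⟩ := lift s hs ![m, m']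
      have hr₀ : t (ι₂ (r 0)) = m := congrFun hr 0
      have hr₁ : t (ι₂ (r 1)) = m' := congrFun hr 1
      have hne : t (ι₂ (r 0)) ≠ t (ι₂ (r 1)) := by
        rw [hr₀, hr₁]
        exact hm'.symm
      have hy : t (y 0) = m :=
        ((hX₂θ t ht).resolve_left fun h => h.elim (fun h => hne h.2) fun h => hne h.2).trans hr₀
      refine ⟨t, ht, ?_⟩
      rw [← hy]
      exact comp_renameInsert _ _ _ _
    · rintro ⟨t, ht, rfl⟩
      have ht' : t ∘ ι₂ ∈ X₂.pull ι₂ := ⟨t, ht, rfl⟩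
      rw [hX₂] at ht'
      exact ⟨_, ⟨_, ht', rfl⟩, _, comp_renameInsert _ _ _ _⟩
  · obtain ⟨_, ⟨s₁, hs₁, m₁, rfl⟩, _, ⟨s₂, hs₂, m₂, rfl⟩, a, ha⟩ := h₁.complete M _ hX
    set G₁ : (W₂ → M) → Prop := fun s => F₁ M ((s ∘ ι₂) ∘ ι₁) ∧ s (ι₂ (r 0)) = s (ι₂ (r 1)) with hG₁
    set G₂ : (W₂ → M) → Prop := fun s => F₂ M ((s ∘ ι₂) ∘ ι₁) ∧ s (ι₂ (r 0)) = s (ι₂ (r 1)) with hG₂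
    refine ⟨s₁, hs₁, s₂, hs₂, a, fun X' hX₁ hX₂ => (h₃ M X').2 ((h₂ M _).2 ⟨{s |
      (s ∘ ι₂) ∘ ι₁ ∈ X' ∧ (G₁ s → s (y 0) = m₁) ∧ (G₂ s → s (y 0) = m₂) ∧
      (¬ G₁ s → ¬ G₂ s → s (y 0) = s (ι₂ (r 0)))}, ?_, (hθ M _).2 fun s hs => ?_, ha _ ?_ ?_⟩)⟩
    · ext s
      constructor
      · rintro ⟨s, hs, rfl⟩
        exact hs.1
      · intro hs
        set K₁ := F₁ M (s ∘ ι₁) ∧ s (r 0) = s (r 1) with hK₁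
        set K₂ := F₂ M (s ∘ ι₁) ∧ s (r 0) = s (r 1) with hK₂
        have : ∃ m, (K₁ → m = m₁) ∧ (K₂ → m = m₂) ∧ (¬ K₁ → ¬ K₂ → m = s (r 0)) := by
          by_cases hF₁ : K₁
          · exact ⟨m₁, fun _ => rfl, fun h => (hF.disjoint hF₁.1 h.1).elim, fun h => (h hF₁).elim⟩
          by_cases hF₂ : K₂
          · exact ⟨m₂, fun h => (hF₁ h).elim, fun _ => rfl, fun _ h => (h hF₂).elim⟩
          exact ⟨s (r 0), fun h => (hF₁ h).elim, fun h => (hF₂ h).elim, fun _ _ => rfl⟩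
        obtain ⟨m, hm⟩ := this
        obtain ⟨s', rfl, hm'⟩ := hι₂.exists_extend s (fun _ => m)
        obtain rfl : s' (y 0) = m := congrFun hm' 0
        exact ⟨s', ⟨hs, hm⟩, rfl⟩
    · by_contra hc
      have hc₁ : ¬ G₁ s := fun h => hc (Or.inl (Or.inl h))
      have hc₂ : ¬ G₂ s := fun h => hc (Or.inl (Or.inr h))
      exact hc (Or.inr (hs.2.2.2 hc₁ hc₂))
    · rintro s ⟨hs, hm⟩
      obtain ⟨hsX, hw, e₁, e₂⟩ := hX₁ _ hs
      rw [comp_renameInsert]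
      refine ⟨⟨_, hsX, _, rfl⟩, hw, fun h => ?_, fun h => ?_⟩
      · rw [hm.1 h, ← e₁ h.1]
        rfl
      · rw [hm.2.1 h, ← e₂ h.1]
        rfl
    · rintro _ ⟨s, hs, m, rfl⟩
      obtain ⟨m', hm'⟩ := exists_ne m
      obtain ⟨s', hs', rfl, -⟩ := hX₂ s hs
      obtain ⟨s', rfl, hr⟩ := hι₁.exists_extend s' ![m, m']
      obtain ⟨s', rfl, hy⟩ := hι₂.exists_extend s' (fun _ => m)
      have hr₀ : s' (ι₂ (r 0)) = m := congrFun hr 0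
      have hr₁ : s' (ι₂ (r 1)) = m' := congrFun hr 1
      have hy : s' (y 0) = m := congrFun hy 0
      have hne : s' (ι₂ (r 0)) ≠ s' (ι₂ (r 1)) := by
        rw [hr₀, hr₁]
        exact hm'.symm
      refine ⟨s', ⟨hs', fun h => (hne h.2).elim, fun h => (hne h.2).elim, fun _ _ => hy.trans hr₀.symm⟩,
        ?_, fun h => hne h.2, fun h => hne h.2⟩
      rw [comp_renameInsert, hy]
      rfl

/-- Any formula with an atom outside `D` is eliminable, if all such atoms are non-constancy atoms. -/
theorem of_pos (hE : ∀ d ∈ E, d ∉ D → d ∈ NC) (φ : TeamFormula L E V) (h : 0 < atomsOutside D φ) :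
    Eliminable.{u, v, w} D φ := by
  induction φ with
  | eq | ne | rel | nrel => simp [atomsOutside] at h
  | dep d hd ts =>
    have hD : d ∉ D := fun hD => by simp [atomsOutside, hD] at h
    exact dep hd hD (hE d hd hD) ts
  | or φ ψ ih₁ ih₂ =>
    exact (Nat.add_pos_iff_pos_or_pos).1 h |>.elim (fun h => (ih₁ h).or_left ψ)
      fun h => (ih₂ h).or_right φ
  | and φ ψ ih₁ ih₂ =>
    exact (Nat.add_pos_iff_pos_or_pos).1 h |>.elim (fun h => (ih₁ h).and_left ψ)
      fun h => (ih₂ h).and_right φ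
  | ex x φ ih => exact (ih h).ex
  | all x φ ih => exact (ih h).all

/-- An eliminable sentence is equivalent to one with one atom outside `D` less. -/
theorem exists_sentence {φ : TeamSentence L E} (h : Eliminable.{u, v, w} D φ) :
    ∃ φ' : TeamSentence L E, atomsOutside D φ' + 1 = atomsOutside D φ ∧
      ∀ (M : Type w) [L.Structure M] [Nontrivial M], TrueIn M φ ↔ TrueIn M φ' := by
  obtain ⟨k, h⟩ := h
  obtain ⟨W₁, ι₁, w, hι₁⟩ := exists_isExtension.{u, v, w} L E D ∅ k
  obtain ⟨W₂, ι₂, p, hι₂⟩ := exists_isExtension.{u, v, w} L E D W₁ 3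
  -- The flags are coded by equalities among three variables: `p₀ = p₁ = p₂` is the first, `p₀ = p₁
  -- ≠ p₂` the second, and `p₀ ≠ p₁` means unflagged. All three patterns occur in a two-element
  -- model.
  have hF : IsFlagPair L E D (fun (M : Type w) (s : W₂ → M) => s (p 1) = s (p 2) ∧ s (p 0) = s (p 1))
      (fun M s => ¬ s (p 1) = s (p 2) ∧ s (p 0) = s (p 1)) :=
    IsFlagPair.and_eq ⟨.eq (.var (p 1)) (.var (p 2)), .ne (.var (p 1)) (.var (p 2)),
      .ne (.var (p 1)) (.var (p 2)), (FlatDefinable.eq (.var (p 1)) (.var (p 2))).congr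
        fun M _ s => by simp, not_not_intro⟩ _ _
  obtain ⟨φ₁, c₁, h₁⟩ := h (ι₂ ∘ ι₁) (ι₂ ∘ w) _ _ hF
  obtain ⟨φ₂, c₂, h₂⟩ := hι₂.exists_all φ₁
  obtain ⟨φ₃, c₃, h₃⟩ := hι₁.exists_ex φ₂
  have hε : ∀ {M : Type w} (s : ↥(∅ : Finset ℕ) → M), s = emptyAssignment M := fun s =>
    Subsingleton.elim _ _
  refine ⟨φ₃, by omega, fun M _ _ => ?_⟩
  obtain ⟨m₀, m₁, hm⟩ := exists_pair_ne M
  rw [TrueIn, TrueIn, h₃]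
  constructor
  · intro hs
    obtain ⟨s₁, -, s₂, -, a, ha⟩ := h₁.complete M _ hs
    refine ⟨{s | s ∘ w = a}, ?_, (h₂ M _).2 (ha _ ?_ ?_)⟩
    · ext s
      obtain ⟨s', -, hs'⟩ := hι₁.exists_extend s a
      exact ⟨fun _ => hε s, fun _ => ⟨s', hs', Subsingleton.elim _ _⟩⟩
    -- Over the empty domain there is only one assignment, so both witnesses are `ε` and lying over
    -- them is automatic.
    · exact fun s hs => ⟨hε _, hs, fun _ => Subsingleton.elim _ _, fun _ => Subsingleton.elim _ _⟩
    · intro s _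
      obtain ⟨s', rfl, hs'⟩ := hι₁.exists_extend s a
      obtain ⟨s', rfl, hp⟩ := hι₂.exists_extend s' ![m₀, m₁, m₁]
      have hne : s' (p 0) ≠ s' (p 1) := by
        rw [show s' (p 0) = m₀ from congrFun hp 0, show s' (p 1) = m₁ from congrFun hp 1]
        exact hm
      exact ⟨s', hs', rfl, fun h => hne h.2, fun h => hne h.2⟩
  · rintro ⟨X, hX, hs⟩
    obtain ⟨s, hs', -⟩ : emptyAssignment M ∈ X.pull ι₁ := by
      rw [hX]
      rfl
    -- Both flagged assignments extend the same `s`, so they agree on `w`.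
    obtain ⟨t₁, ht₁, hp₁⟩ := hι₂.exists_extend s ![m₀, m₀, m₀]
    obtain ⟨t₂, ht₂, hp₂⟩ := hι₂.exists_extend s ![m₀, m₀, m₁]
    have hs₁ : t₁ ∘ ι₂ ∈ X := ht₁ ▸ hs'
    have hs₂ : t₂ ∘ ι₂ ∈ X := ht₂ ▸ hs'
    have e₁ : ∀ i, t₁ (p i) = ![m₀, m₀, m₀] i := congrFun hp₁
    have e₂ : ∀ i, t₂ (p i) = ![m₀, m₀, m₁] i := congrFun hp₂
    have := h₁.sound M _ ⟨t₁, hs₁, t₂, hs₂, by simp [e₁], by simp [e₂, hm], by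
      rw [← Function.comp_assoc, ← Function.comp_assoc, ht₁, ht₂]⟩ ((h₂ M _).1 hs)
    convert this
    ext s
    exact ⟨fun _ => ⟨t₁, hs₁, Subsingleton.elim _ _⟩, fun _ => hε s⟩

end Eliminable

/-! ### Safety -/

theorem safe_NC (D : Set Dependency) : Safe.{u, v, w} NC D := by
  intro L φ
  obtain ⟨n, hn⟩ : ∃ n, atomsOutside D φ = n := ⟨_, rfl⟩
  induction n generalizing φ with
  | zero =>
    obtain ⟨ψ, hψ⟩ := exists_translation.{u, v, w} (E := NC ∪ D) (D := D) (D' := D)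
      (fun V d _ ts hD => ⟨.dep d hD ts, fun M _ _ X => Iff.rfl⟩) φ hn
    exact ⟨ψ, fun M _ _ => hψ M _⟩
  | succ n ih =>
    obtain ⟨φ₁, c₁, h₁⟩ := (Eliminable.of_pos.{u, v, w} (D := D)
      (fun d hd hD => hd.resolve_right hD) φ (by omega)).exists_sentence
    obtain ⟨φ₂, h₂⟩ := ih φ₁ (by omega)
    exact ⟨φ₂, fun M _ _ => (h₁ M).trans (h₂ M)⟩

theorem safe_NE (D : Set Dependency) : Safe.{u, v, w} NE D := by
  intro L φ
  -- Nonemptiness of `X(t)` is that of the team, so the tuple `t` can be dropped and a unary `NC`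
  -- atom suffices for every arity.
  obtain ⟨φ₁, h₁⟩ := exists_translation.{u, v, w} (E := NE ∪ D) (D := NE ∪ D) (D' := NC ∪ D)
    (fun V d hd ts _ => by
      by_cases hD : d ∈ D
      · exact ⟨.dep d (Or.inr hD) ts, fun M _ _ X => Iff.rfl⟩
      refine ⟨.all 0 (.dep (nonConstancy 1) (Or.inl ⟨1, rfl⟩)
        fun _ => .var ⟨0, Finset.mem_insert_self 0 V⟩), fun M _ _ X => ?_⟩
      simp only [Sat]
      rw [holds_of_mem_NE (hd.resolve_right hD), nonConstancy_holds, toRel_nonempty]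
      constructor
      · rintro ⟨s, hs⟩
        obtain ⟨m₀, m₁, hm⟩ := exists_pair_ne M
        refine ⟨fun _ => m₀, ⟨_, ⟨s, hs, m₀, rfl⟩, ?_⟩, fun _ => m₁, ⟨_, ⟨s, hs, m₁, rfl⟩, ?_⟩,
          fun e => hm (congrFun e 0)⟩ <;>
        simp [updateAt_self]
      · intro h
        obtain ⟨_, ⟨s, hs, _⟩⟩ := toRel_nonempty.1 h.nonempty
        exact ⟨s, hs⟩) φ (atomsOutside_self φ)
  obtain ⟨φ₂, h₂⟩ := safe_NC D L φ₁
  exact ⟨φ₂, fun M _ _ => (h₁ M _).trans (h₂ M)⟩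

/-! ### Definability -/

theorem definableIn_nonEmptiness (k : ℕ) : DefinableIn.{u, v, w} (nonEmptiness k) All := by
  intro L x _
  refine ⟨.all 0 (.dep (totality 1) ⟨1, rfl⟩ fun _ => .var ⟨0, Finset.mem_insert_self 0 _⟩),
    fun M _ _ X => ?_⟩
  simp only [Sat]
  rw [nonEmptiness_holds, totality_holds, toRel_nonempty]
  obtain ⟨m, -⟩ := exists_pair_ne M
  constructor
  · rintro ⟨s, hs⟩
    refine Set.eq_univ_of_forall fun b => ⟨_, ⟨s, hs, b 0, rfl⟩, ?_⟩
    funext i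
    rw [Subsingleton.elim i 0, Term.realize_var, updateAt_self]
  · intro h
    obtain ⟨_, ⟨s, hs, _⟩, _⟩ := Set.eq_univ_iff_forall.1 h fun _ => m
    exact ⟨s, hs⟩

/-- `X(t)` has two elements iff every tuple `b` differs from some value of `t`. With `w` universally
quantified, totality of `w` on a part of the team where `w ≠ t` says exactly this. -/
theorem definableIn_nonConstancy (k : ℕ) : DefinableIn.{u, v, w} (nonConstancy k) All := by
  intro L x _
  set V := Finset.univ.image x
  set t : Fin k → L.Term V :=
    fun i => .var ⟨x i, Finset.mem_image_of_mem x (Finset.mem_univ i)⟩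
  obtain ⟨W, ι, w, hι⟩ := exists_isExtension.{u, v, w} L All All V k
  obtain ⟨α, -, hα⟩ := FlatDefinable.tuple_eq.{u, v, w} (E := All) (D := All)
    (fun i => (t i).relabel ι) fun i => .var (w i)
  obtain ⟨β, -, hβ⟩ := FlatDefinable.tuple_ne.{u, v, w} (E := All) (D := All)
    (fun i => (t i).relabel ι) fun i => .var (w i)
  obtain ⟨ψ, -, hψ⟩ := hι.exists_all (.or α (.and β (.dep (totality k) ⟨k, rfl⟩
    fun i => .var (w i))))
  refine ⟨ψ, fun M _ _ X => ?_⟩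
  rw [hψ]
  simp only [Sat, hα, hβ]
  rw [nonConstancy_holds]
  simp only [totality_holds, Term.realize_relabel, Term.realize_var]
  constructor
  · rintro ⟨_, ⟨s₁, hs₁, rfl⟩, _, ⟨s₂, hs₂, rfl⟩, hne⟩
    refine ⟨{s | s ∘ ι ∈ X ∧ ∀ i, (t i).realize (s ∘ ι) = s (w i)},
      {s | s ∘ ι ∈ X ∧ ¬ ∀ i, (t i).realize (s ∘ ι) = s (w i)}, ?_, fun s hs => hs.2,
      fun s hs => hs.2, Set.eq_univ_of_forall fun b => ?_⟩
    · ext s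
      exact ⟨fun hs => (em _).imp (fun h => ⟨hs, h⟩) fun h => ⟨hs, h⟩,
        fun h => h.elim (fun h => h.1) fun h => h.1⟩
    · obtain ⟨s, hs, hb⟩ : ∃ s ∈ X, (fun i => (t i).realize s) ≠ b := by
        by_contra! h
        exact hne ((h s₁ hs₁).trans (h s₂ hs₂).symm)
      obtain ⟨s, rfl, rfl⟩ := hι.exists_extend s b
      exact ⟨s, ⟨hs, fun h => hb (funext h)⟩, rfl⟩
  · rintro ⟨Y, Z, hYZ, -, hZ, hu⟩
    have key : ∀ b : Fin k → M, ∃ s ∈ X, (fun i => (t i).realize s) ≠ b := by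
      intro b
      obtain ⟨s, hs, rfl⟩ := Set.eq_univ_iff_forall.1 hu b
      have hs' : s ∈ Y ∪ Z := Or.inr hs
      rw [← hYZ] at hs'
      exact ⟨_, hs', fun e => hZ s hs fun i => congrFun e i⟩
    obtain ⟨m, -⟩ := exists_pair_ne M
    -- An arbitrary tuple shows that the team is nonempty; the value of `t` at the assignment found
    -- then yields a second value.
    obtain ⟨s₁, hs₁, -⟩ := key fun _ => m
    obtain ⟨s₂, hs₂, h⟩ := key fun i => (t i).realize s₁
    exact ⟨_, ⟨s₂, hs₂, rfl⟩, _, ⟨s₁, hs₁, rfl⟩, h⟩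

end TeamSem

theorem mainTheorem4 :
    -- the satisfaction conditions of the atoms `NC(t)` and `NE(t)`, for tuples `t` of terms
    (∀ (D : Set TeamSem.Dependency) (L : FirstOrder.Language.{u, v}) (M : Type w) [L.Structure M]
        [Nontrivial M] (V : Finset ℕ) (X : TeamSem.Team M V) (k : ℕ) (ts : Fin k → L.Term V),
        (∀ h : TeamSem.nonConstancy k ∈ D,
          TeamSem.Sat X (TeamSem.TeamFormula.dep (D := D) (TeamSem.nonConstancy k) h ts) ↔
            2 ≤ (X.toRel ts).encard) ∧
        (∀ h : TeamSem.nonEmptiness k ∈ D,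
          TeamSem.Sat X (TeamSem.TeamFormula.dep (D := D) (TeamSem.nonEmptiness k) h ts) ↔
            0 < (X.toRel ts).encard)) ∧
    -- safety for every family of dependencies
    (∀ D : Set TeamSem.Dependency,
      TeamSem.Safe.{u, v, w} TeamSem.NC D ∧ TeamSem.Safe.{u, v, w} TeamSem.NE D) ∧
    -- definability from totality atoms
    (∀ k : ℕ, TeamSem.DefinableIn.{u, v, w} (TeamSem.nonConstancy k) TeamSem.All ∧
      TeamSem.DefinableIn.{u, v, w} (TeamSem.nonEmptiness k) TeamSem.All) := by
  refine ⟨fun D L M _ _ V X k ts => ⟨fun h => ?_, fun h => ?_⟩,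
    fun D => ⟨TeamSem.safe_NC D, TeamSem.safe_NE D⟩,
    fun k => ⟨TeamSem.definableIn_nonConstancy k, TeamSem.definableIn_nonEmptiness k⟩⟩
  · rw [TeamSem.Sat, TeamSem.nonConstancy_holds, ← Set.one_lt_encard_iff_nontrivial,
      ← one_add_one_eq_two, ENat.add_one_le_iff ENat.one_ne_top]
  · rw [TeamSem.Sat, TeamSem.nonEmptiness_holds, Set.encard_pos]
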